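/- **Setting.** Let $U$ be a finite set of items, $M$ a matroid on $U$, and $d\ge 1$ an integer. An instance of the profit-maximization problem consists of a value function $v:2^U\to\mathbb R$, a size $s(e)\in\mathbb R_+^d$ for every item $e$, and a cost function $g:\mathbb R_+^d\to\mathbb R_+$ that is non-decreasing and convex with $g(0)=0$. The profit of $A\subseteq U$ is $\pi(A)=v(A)-g\big(\sum_{e\in A}s(e)\big)$, and $\mathsf{opt}=\max\{\pi(A): A \text{ independent in } M\}$. The value functions range over an arbitrary fixed class $\mathcal V$ of submodular set functions with $v(\emptyset)=0$ (for instance all of them, or the additive ones). The cost $g$ is *separable* if $g(z)=\sum_{i=1}^d h_i(z_i)$ for one-dimensional functions $h_i$, and *supermodular* if $g(x)+g(y)\le g(x\wedge y)+g(x\vee y)$ for all $x,y\in\mathbb R_+^d$, with coordinatewise minimum and maximum. Algorithms are randomized online algorithms in the random-order model: $U$, $M$ and $g$ are known, the items arrive in uniformly random order, the size of an item and the values of the sets it forms with earlier items are revealed at its arrival, and it must then be irrevocably accepted or rejected. The accepted set must be independent in $M$. For $\rho>0$, an algorithm is a *$\rho$-approximation* on a class of instances if on each of them its expected profit (over the arrival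 order and its own randomness) is at least $\mathsf{opt}/\rho$. A *single-item secretary algorithm* always accepts at most one item and, on each instance with $v\in\mathcal V$ and supermodular $g$, has expected profit at least $\frac1{\mathrm e}\max\{\pi(A): A \text{ independent in } M,\ |A|\le 1\}$. For a cost $g$ let $g_i(x)=g(x\,\mathbf e_i)$ be its marginal functions and $\overline g(y)=\frac1d\sum_{i=1}^d g_i(d\,y_i)$. **Theorem (Reduction).** Let $\beta>0$ and let $\mathscr A$ be a $\beta$-approximation algorithm for profit maximization over $M$ on all instances with $v\in\mathcal V$ and separable convex cost. Then single-item secretary algorithms exist and, for every single-item secretary algorithm $\mathscr S$, the following algorithm is a $d(\beta+2\mathrm e d)$-approximation for profit maximization over $M$ on all instances with $v\in\mathcal V$ and supermodular convex cost $g$: with probability $\frac{\beta}{\beta+2\mathrm e d}$ run $\mathscr A$ on the same items and values with the cost $\overline g$, and with the remaining probability $\frac{2\mathrm e d}{\beta+2\mathrm e d}$ run $\mathscr S$. -/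

import Mathlib

open scoped NNReal
open MeasureTheory

/-! ### Instances of profit maximization -/

/-- An instance of the profit-maximization problem on the universe `U` with `d` resources: a set
function giving the value of a set of items, the nonnegative size vector of each item, and a cost
function `ℝ₊^d → ℝ₊`. -/
structure ProfitInstance (U : Type*) (d : ℕ) where
  value : Finset U → ℝ
  size : U → Fin d → ℝ≥0
  cost : (Fin d → ℝ≥0) → ℝ≥0

/-- A normalized (discrete) submodular set function. -/
def IsSubmodularValue {U : Type*} [DecidableEq U] (v : Finset U → ℝ) : Prop :=
  v ∅ = 0 ∧ ∀ A B : Finset U, v (A ∪ B) + v (A ∩ B) ≤ v A + v B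

/-- A cost function on the positive orthant: nondecreasing, convex, and zero at the origin. -/
def IsConvexCost {d : ℕ} (g : (Fin d → ℝ≥0) → ℝ≥0) : Prop :=
  g 0 = 0 ∧ Monotone g ∧ ConvexOn ℝ≥0 Set.univ g

/-- Supermodularity on the lattice `ℝ₊^d` (coordinatewise minimum and maximum). -/
def IsSupermodularCost {d : ℕ} (g : (Fin d → ℝ≥0) → ℝ≥0) : Prop :=
  ∀ x y : Fin d → ℝ≥0, g x + g y ≤ g (x ⊓ y) + g (x ⊔ y)

/-- `g` is separable: `g z = ∑ i, h i (z i)` for one-dimensional functions `h i`. -/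
def IsSeparableCost {d : ℕ} (g : (Fin d → ℝ≥0) → ℝ≥0) : Prop :=
  ∃ h : Fin d → ℝ≥0 → ℝ, ∀ z : Fin d → ℝ≥0, (g z : ℝ) = ∑ i, h i (z i)

/-- The `i`-th marginal function `x ↦ g (x eᵢ)`. -/
def marginalCost {d : ℕ} (g : (Fin d → ℝ≥0) → ℝ≥0) (i : Fin d) (x : ℝ≥0) : ℝ≥0 :=
  g (Pi.single i x)

/-- The separable surrogate `y ↦ (1/d) ∑ i, gᵢ (d yᵢ)` of the cost function `g`. -/
noncomputable def separatedCost {d : ℕ} (g : (Fin d → ℝ≥0) → ℝ≥0) (y : Fin d → ℝ≥0) : ℝ≥0 :=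
  (d : ℝ≥0)⁻¹ * ∑ i, marginalCost g i ((d : ℝ≥0) * y i)

namespace ProfitInstance

variable {U : Type*} {d : ℕ}

/-- The profit of a set of items: its value minus the cost of its total size. -/
def profit (I : ProfitInstance U d) (A : Finset U) : ℝ :=
  I.value A - (I.cost (∑ e ∈ A, I.size e) : ℝ)

/-- The instance with the cost replaced by its separable surrogate. -/
noncomputable def separated (I : ProfitInstance U d) : ProfitInstance U d :=
  { I with cost := separatedCost I.cost }

/-- `I` and `J` cannot be told apart by someone who knows the cost function, the sizes of the
items in `X`, and the values of all sets of items in `X`. -/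
def AgreeOn (I J : ProfitInstance U d) (X : Set U) : Prop :=
  I.cost = J.cost ∧ (∀ e ∈ X, I.size e = J.size e) ∧
    ∀ B : Finset U, (B : Set U) ⊆ X → I.value B = J.value B

theorem AgreeOn.separated {I J : ProfitInstance U d} {X : Set U} (h : I.AgreeOn J X) :
    I.separated.AgreeOn J.separated X :=
  ⟨congrArg separatedCost h.1, h.2.1, h.2.2⟩

end ProfitInstance

/-- Instances with separable convex costs and values in the class `𝒱`. -/
def separableInstances {U : Type*} (d : ℕ) (𝒱 : Set (Finset U → ℝ)) :
    Set (ProfitInstance U d) :=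
  {I | I.value ∈ 𝒱 ∧ IsConvexCost I.cost ∧ IsSeparableCost I.cost}

/-- Instances with supermodular convex costs and values in the class `𝒱`. -/
def supermodularInstances {U : Type*} (d : ℕ) (𝒱 : Set (Finset U → ℝ)) :
    Set (ProfitInstance U d) :=
  {I | I.value ∈ 𝒱 ∧ IsConvexCost I.cost ∧ IsSupermodularCost I.cost}

/-! ### Online algorithms in the random-order model -/

/-- An arrival order of the items of `U`. -/
abbrev ArrivalOrder (U : Type*) [Fintype U] := Fin (Fintype.card U) ≃ U

/-- A randomized online algorithm for profit maximization over the matroid `M`. The universe, the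
matroid, and the cost function are known in advance. The size of an item, and the values of the sets
that contain it, are revealed when the item (and, for a set, its last item) arrives. The algorithm
must accept or reject each item at its arrival, irrevocably. `select ω I σ` is the set of
items accepted on the instance `I` with arrival order `σ` and internal randomness `ω`. -/
structure OnlineAlgorithm {U : Type*} [Fintype U] (M : Matroid U) (d : ℕ) where
  /-- The internal randomness of the algorithm. -/
  Ω : Type
  [measurableSpace : MeasurableSpace Ω]
  μ : Measure Ω
  [isProbabilityMeasure : IsProbabilityMeasure μ]
  select : Ω → ProfitInstance U d → ArrivalOrder U → Finset U
  measurableSet_select : ∀ (I : ProfitInstance U d) (σ : ArrivalOrder U) (B : Finset U),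
    MeasurableSet {ω | select ω I σ = B}
  indep_select : ∀ (ω : Ω) (I : ProfitInstance U d) (σ : ArrivalOrder U),
    M.Indep (select ω I σ : Set U)
  /-- The decision on the item arriving at time `t` depends only on what is revealed up to `t`. -/
  nonanticipating : ∀ (ω : Ω) (I J : ProfitInstance U d) (σ τ : ArrivalOrder U)
    (t : Fin (Fintype.card U)), (∀ i ≤ t, σ i = τ i) → I.AgreeOn J (σ '' Set.Iic t) →
      (σ t ∈ select ω I σ ↔ τ t ∈ select ω J τ)

namespace OnlineAlgorithm

attribute [instance] OnlineAlgorithm.measurableSpace OnlineAlgorithm.isProbabilityMeasure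

variable {U : Type*} [Fintype U] {M : Matroid U} {d : ℕ}

/-- Every function of the accepted set is integrable with respect to the internal randomness. -/
theorem integrable_select (A : OnlineAlgorithm M d) (I : ProfitInstance U d) (σ : ArrivalOrder U)
    (f : Finset U → ℝ) : Integrable (fun ω => f (A.select ω I σ)) A.μ := by
  classical
  have h : (fun ω => f (A.select ω I σ)) =
      fun ω => ∑ B : Finset U, ({ω | A.select ω I σ = B}.indicator (fun _ => f B)) ω := by
    funext ω
    simp [Set.indicator_apply]
  rw [h]
  exact integrable_finsetSum _ fun B _ =>
    (integrable_const (f B)).indicator (A.measurableSet_select I σ B)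

/-- The expected profit, over a uniformly random arrival order and the internal randomness. -/
noncomputable def expectedProfit [DecidableEq U] (A : OnlineAlgorithm M d)
    (I : ProfitInstance U d) : ℝ :=
  (∑ σ : ArrivalOrder U, ∫ ω, I.profit (A.select ω I σ) ∂A.μ) / (Fintype.card (ArrivalOrder U) : ℝ)

/-- `A` is a `ρ`-approximation on the class `C` of instances: on each instance in `C`, the maximum
profit of a feasible (i.e. independent) set is at most `ρ` times the expected profit of `A`. -/
def IsApproximation [DecidableEq U] (A : OnlineAlgorithm M d) (ρ : ℝ)
    (C : Set (ProfitInstance U d)) : Prop :=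
  ∀ I ∈ C, ∀ B : Finset U, M.Indep (B : Set U) → I.profit B ≤ ρ * A.expectedProfit I

/-- `A` is a single-item secretary algorithm on the class `C`: it accepts at most one item, and
its expected profit is at least a `1/e` fraction of the best profit of a feasible set of at most one
item. -/
def IsSingleSecretary [DecidableEq U] (A : OnlineAlgorithm M d)
    (C : Set (ProfitInstance U d)) : Prop :=
  (∀ (ω : A.Ω) (I : ProfitInstance U d) (σ : ArrivalOrder U), (A.select ω I σ).card ≤ 1) ∧
    ∀ I ∈ C, ∀ B : Finset U, M.Indep (B : Set U) → B.card ≤ 1 →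
      (Real.exp 1)⁻¹ * I.profit B ≤ A.expectedProfit I

/-- Run `A` on the instance whose cost is replaced by its separable surrogate. -/
noncomputable def onSeparated (A : OnlineAlgorithm M d) : OnlineAlgorithm M d where
  Ω := A.Ω
  μ := A.μ
  select ω I σ := A.select ω I.separated σ
  measurableSet_select I σ B := A.measurableSet_select I.separated σ B
  indep_select ω I σ := A.indep_select ω I.separated σ
  nonanticipating ω I J σ τ t hστ hIJ :=
    A.nonanticipating ω I.separated J.separated σ τ t hστ hIJ.separated

/-- Run `A` with probability `q`, and `B` with the remaining probability. -/
noncomputable def mix (q : unitInterval) (A B : OnlineAlgorithm M d) : OnlineAlgorithm M d where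
  Ω := A.Ω ⊕ B.Ω
  μ := ENNReal.ofReal q • A.μ.map Sum.inl + ENNReal.ofReal (1 - q) • B.μ.map Sum.inr
  isProbabilityMeasure := by
    constructor
    rw [Measure.add_apply, Measure.smul_apply, Measure.smul_apply,
      Measure.map_apply measurable_inl MeasurableSet.univ,
      Measure.map_apply measurable_inr MeasurableSet.univ]
    simp only [Set.preimage_univ, measure_univ, smul_eq_mul, mul_one]
    rw [← ENNReal.ofReal_add q.2.1 (sub_nonneg.2 q.2.2)]
    simp
  select ω I σ := ω.elim (fun a => A.select a I σ) (fun b => B.select b I σ)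
  measurableSet_select I σ S :=
    measurableSet_sum_iff.2 ⟨A.measurableSet_select I σ S, B.measurableSet_select I σ S⟩
  indep_select ω I σ := by
    cases ω with
    | inl a => exact A.indep_select a I σ
    | inr b => exact B.indep_select b I σ
  nonanticipating ω I J σ τ t hστ hIJ := by
    cases ω with
    | inl a => exact A.nonanticipating a I J σ τ t hστ hIJ
    | inr b => exact B.nonanticipating b I J σ τ t hστ hIJ

end OnlineAlgorithm

/-- The probability `β / (β + 2 e d)` with which the reduction runs the separable-cost algorithm. -/
noncomputable def separableProb (d : ℕ) (β : ℝ) (hβ : 0 < β) : unitInterval :=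
  ⟨β / (β + 2 * Real.exp 1 * d), by positivity,
    div_le_one_of_le₀ (le_add_of_nonneg_right (by positivity)) (by positivity)⟩

/-- The reduction: with probability `β / (β + 2 e d)` run `A` on the same items with the separable
surrogate cost, and with the remaining probability `2 e d / (β + 2 e d)` run the single-item
algorithm `S`. -/
noncomputable def OnlineAlgorithm.reduction {U : Type*} [Fintype U] {M : Matroid U} {d : ℕ}
    (β : ℝ) (hβ : 0 < β) (A S : OnlineAlgorithm M d) : OnlineAlgorithm M d :=
  OnlineAlgorithm.mix (separableProb d β hβ) A.onSeparated S

/-! Fix an independent set B of total size z. Give each item e the price ℓ(e), the larger of its own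
cost g(s(e)) and its secant price ∑ᵢ (s(e)ᵢ / zᵢ) gᵢ(zᵢ). Convexity and supermodularity make these
prices sum to at most g(z) over B (`sum_max_secantCost_le`). A Carathéodory argument
(`exists_balanced_coloring`) sets aside at most d² + 1 items and splits the rest of B into d parts,
each of size at most z/d in every coordinate. On such a part the surrogate cost is at most the
secant price, because the slopes gᵢ(x)/x are nondecreasing; an item set aside costs at most ℓ(e) on
its own. Subadditivity of v then bounds the profit of B by d times the best surrogate profit of a
subset plus d² + 1 times the best single-item profit (`profit_le_of_separated`).

Conversely, Jensen's inequality gives g ≤ ḡ, so a set chosen under the surrogate earns at least as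
much under g. The mixing probabilities weigh the two bounds, using d² + 1 ≤ 2d².

For the existence of a single-item algorithm, the classical secretary rule observes about n/e items.
The guarantee 1/e holds for every n, not only in the limit, because a trapezoid correction in the
harmonic sum outweighs the rounding loss. -/

/-! ### Inequalities for supermodular convex costs -/

section Cost

variable {d : ℕ} {g : (Fin d → ℝ≥0) → ℝ≥0}

/-- Convexity along a segment, with real arithmetic. -/
theorem IsConvexCost.map_add_smul_le (hg : IsConvexCost g) (p q : Fin d → ℝ≥0) {θ : ℝ≥0}
    (hθ : θ ≤ 1) :
    (g (p + θ • q) : ℝ) ≤ (1 - (θ : ℝ)) * g p + θ * g (p + q) := by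
  have h := hg.2.2.2 (Set.mem_univ p) (Set.mem_univ (p + q)) (zero_le (a := 1 - θ)) (zero_le (a := θ))
    (tsub_add_cancel_of_le hθ)
  have e : (1 - θ) • p + θ • (p + q) = p + θ • q := by
    rw [smul_add, ← add_assoc, ← add_smul, tsub_add_cancel_of_le hθ, one_smul]
  rw [e] at h
  have h' : (g (p + θ • q) : ℝ) ≤ ((1 - θ) • g p + θ • g (p + q) : ℝ≥0) := by exact_mod_cast h
  simpa [NNReal.coe_sub hθ] using h'

theorem IsConvexCost.map_smul_le (hg : IsConvexCost g) (q : Fin d → ℝ≥0) {θ : ℝ≥0}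
    (hθ : θ ≤ 1) : (g (θ • q) : ℝ) ≤ θ * g q := by
  simpa [hg.1] using hg.map_add_smul_le 0 q hθ

/-- Both intermediate points lie on the segment from `w` to `w + Pi.single i (x + y)`, with
complementary weights. -/
theorem IsConvexCost.add_single_increment (hg : IsConvexCost g) (w : Fin d → ℝ≥0) (i : Fin d)
    (x y : ℝ≥0) :
    (g (w + Pi.single i x) : ℝ) + g (w + Pi.single i y) ≤ g (w + Pi.single i (x + y)) + g w := by
  rcases eq_or_ne (x + y) 0 with h | h
  · obtain ⟨rfl, rfl⟩ := add_eq_zero.1 h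
    simp
  have hx := hg.map_add_smul_le w (Pi.single i (x + y)) (θ := x / (x + y))
    (div_le_one_of_le₀ le_self_add zero_le)
  have hy := hg.map_add_smul_le w (Pi.single i (x + y)) (θ := y / (x + y))
    (div_le_one_of_le₀ le_add_self zero_le)
  rw [← Pi.single_smul, smul_eq_mul, div_mul_cancel₀ _ h] at hx hy
  have hxy : ((x / (x + y) : ℝ≥0) : ℝ) + ((y / (x + y) : ℝ≥0) : ℝ) = 1 := by
    rw [← NNReal.coe_add, ← add_div, div_self h, NNReal.coe_one]
  have : ((y / (x + y) : ℝ≥0) : ℝ) = 1 - ((x / (x + y) : ℝ≥0) : ℝ) := by linarith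
  rw [this] at hy
  linarith

/-- A supermodular convex cost has increasing differences. -/
theorem IsConvexCost.increasing_differences (hg : IsConvexCost g) (hs : IsSupermodularCost g)
    {w' w : Fin d → ℝ≥0} (hw : w' ≤ w) (i : Fin d) (c : ℝ≥0) :
    (g w : ℝ) + g (w' + Pi.single i c) ≤ g w' + g (w + Pi.single i c) := by
  -- Convexity handles the increase from `w'` to `w` in coordinate `i` itself, where supermodularity
  -- is silent; `h2` handles the other coordinates.
  have h1 := hg.add_single_increment w' i (w i - w' i) c
  have h2 := hs w (w' + Pi.single i (w i - w' i + c))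
  have e1 : w ⊓ (w' + Pi.single i (w i - w' i + c)) = w' + Pi.single i (w i - w' i) := by
    funext j
    rcases eq_or_ne j i with rfl | hj
    · simp [← add_assoc, add_tsub_cancel_of_le (hw j)]
    · simp [hj, hw j]
  have e2 : w ⊔ (w' + Pi.single i (w i - w' i + c)) = w + Pi.single i c := by
    funext j
    rcases eq_or_ne j i with rfl | hj
    · simp [← add_assoc, add_tsub_cancel_of_le (hw j)]
    · simp [hj, hw j]
  rw [e1, e2] at h2
  have h2' : (g w : ℝ) + g (w' + Pi.single i (w i - w' i + c)) ≤
    g (w' + Pi.single i (w i - w' i)) + g (w + Pi.single i c) := by exact_mod_cast h2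
  linarith

/-- Build up `y` one coordinate at a time: by increasing differences, each increment costs at least
as much on top of `x` as without it. -/
theorem IsConvexCost.superadditive (hg : IsConvexCost g) (hs : IsSupermodularCost g)
    (x y : Fin d → ℝ≥0) : (g x : ℝ) + g y ≤ g (x + y) := by
  have key : ∀ s : Finset (Fin d), (g x : ℝ) + g (∑ i ∈ s, Pi.single i (y i)) ≤
      g (x + ∑ i ∈ s, Pi.single i (y i)) := by
    intro s
    induction s using Finset.induction_on with
    | empty => simp [hg.1]
    | insert i s hi ih =>
      have h := hg.increasing_differences hs
        (le_add_self : (∑ i ∈ s, Pi.single i (y i)) ≤ x + ∑ i ∈ s, Pi.single i (y i)) i (y i)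
      rw [Finset.sum_insert hi, add_comm _ (∑ i ∈ s, _), ← add_assoc]
      linarith
  simpa [Finset.univ_sum_single] using key Finset.univ

theorem IsConvexCost.sum_le_map_sum (hg : IsConvexCost g) (hs : IsSupermodularCost g)
    {ι : Type*} (s : Finset ι) (x : ι → Fin d → ℝ≥0) :
    ∑ e ∈ s, (g (x e) : ℝ) ≤ g (∑ e ∈ s, x e) := by
  classical
  induction s using Finset.induction_on with
  | empty => simp
  | insert i s hi ih =>
    rw [Finset.sum_insert hi, Finset.sum_insert hi]
    linarith [hg.superadditive hs (x i) (∑ e ∈ s, x e)]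

/-- The linearization of the cost at `z`: along each axis, the average slope up to `z`. -/
noncomputable def secantCost (g : (Fin d → ℝ≥0) → ℝ≥0) (z y : Fin d → ℝ≥0) : ℝ :=
  ∑ i, (y i / z i : ℝ) * marginalCost g i (z i)

theorem secantCost_sum {ι : Type*} (z : Fin d → ℝ≥0) (s : Finset ι) (x : ι → Fin d → ℝ≥0) :
    secantCost g z (∑ e ∈ s, x e) = ∑ e ∈ s, secantCost g z (x e) := by
  unfold secantCost
  rw [Finset.sum_comm]
  refine Finset.sum_congr rfl fun i _ => ?_
  rw [← Finset.sum_mul, Finset.sum_apply, NNReal.coe_sum, Finset.sum_div]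

/-- Raise `a` to `z = a + c` one coordinate at a time. Along axis `i`, from a point `w` with `i`-th
coordinate 0, convexity says that the last `cᵢ` units bear at least the share `cᵢ / zᵢ` of the whole
increment, and superadditivity makes that increment at least `gᵢ(zᵢ)`. -/
theorem IsConvexCost.add_secantCost_le (hg : IsConvexCost g) (hs : IsSupermodularCost g)
    (a c : Fin d → ℝ≥0) : (g a : ℝ) + secantCost g (a + c) c ≤ g (a + c) := by
  have key : ∀ s : Finset (Fin d),
      (g a : ℝ) + ∑ i ∈ s, (c i / (a + c) i : ℝ) * marginalCost g i ((a + c) i) ≤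
      g (a + ∑ i ∈ s, Pi.single i (c i)) := by
    intro s
    induction s using Finset.induction_on with
    | empty => simp
    | insert i s hi ih =>
      rw [Finset.sum_insert hi, Finset.sum_insert hi]
      set b := a + ∑ i ∈ s, Pi.single i (c i) with hb
      have hbi : b i = a i := by
        have : ∀ j ∈ s, (Pi.single j (c j) : Fin d → ℝ≥0) i = 0 := fun j hj =>
          Pi.single_eq_of_ne (ne_of_mem_of_not_mem hj hi).symm _
        simp [hb, Finset.sum_eq_zero this]
      have hw : Function.update b i 0 + Pi.single i (a i) = b := by
        funext j
        rcases eq_or_ne j i with rfl | hj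
        · simp [hbi]
        · simp [hj]
      set w := Function.update b i 0
      have e : a + (Pi.single i (c i) + ∑ i ∈ s, Pi.single i (c i)) =
          w + Pi.single i ((a + c) i) := by
        rw [Pi.add_apply, Pi.single_add, ← add_assoc w, hw, hb]
        abel
      rw [e]
      -- If this coordinate vanishes, the quotient is 0 by convention and the point does not move.
      rcases eq_or_ne ((a + c) i) 0 with h0 | h0
      · have hai : a i = 0 := (add_eq_zero.1 h0).1
        have hci : c i = 0 := (add_eq_zero.1 h0).2
        rw [hai, Pi.single_zero, add_zero] at hw
        simpa [h0, hci, hw] using ih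
      have h1 := hg.map_add_smul_le w (Pi.single i ((a + c) i)) (θ := a i / (a + c) i)
        (div_le_one_of_le₀ le_self_add zero_le)
      rw [← Pi.single_smul, smul_eq_mul, div_mul_cancel₀ _ h0, hw] at h1
      have h2 := hg.superadditive hs w (Pi.single i ((a + c) i))
      have h3 : ((a i / (a + c) i : ℝ≥0) : ℝ) = 1 - (c i / (a + c) i : ℝ) := by
        have : ((a + c) i : ℝ) ≠ 0 := by exact_mod_cast h0
        rw [NNReal.coe_div, eq_sub_iff_add_eq, ← add_div, div_eq_one_iff_eq this]
        simp
      rw [h3] at h1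
      have h4 : 0 ≤ (c i / (a + c) i : ℝ) := by positivity
      have h5 := mul_le_mul_of_nonneg_left h2 h4
      unfold marginalCost at ih ⊢
      linarith
  simpa [Finset.univ_sum_single, secantCost] using key Finset.univ

theorem IsConvexCost.map_single_le (hg : IsConvexCost g) (i : Fin d) {x y : ℝ≥0} (h : x ≤ y) :
    (marginalCost g i x : ℝ) ≤ (x / y : ℝ) * marginalCost g i y := by
  rcases eq_or_ne y 0 with rfl | hy
  · obtain rfl := le_antisymm h zero_le
    simp [marginalCost, hg.1]
  · have := hg.map_smul_le (Pi.single i y) (θ := x / y) (div_le_one_of_le₀ h zero_le)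
    rw [← Pi.single_smul, smul_eq_mul, div_mul_cancel₀ _ hy] at this
    simpa [marginalCost] using this

/-- The `i`-th surrogate term is `yᵢ` times the average slope of `gᵢ` up to `d yᵢ`, and average
slopes from 0 are nondecreasing. -/
theorem IsConvexCost.separatedCost_le_secantCost (hd : 0 < d) (hg : IsConvexCost g)
    {y z : Fin d → ℝ≥0} (h : ∀ i, (d : ℝ≥0) * y i ≤ z i) :
    (separatedCost g y : ℝ) ≤ secantCost g z y := by
  unfold separatedCost secantCost
  rw [NNReal.coe_mul, NNReal.coe_inv, NNReal.coe_natCast, NNReal.coe_sum, Finset.mul_sum]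
  refine Finset.sum_le_sum fun i _ => ?_
  have hd' : (d : ℝ) ≠ 0 := by exact_mod_cast hd.ne'
  calc (d : ℝ)⁻¹ * marginalCost g i (d * y i)
      ≤ (d : ℝ)⁻¹ * ((((d : ℝ≥0) * y i : ℝ≥0) / z i : ℝ) * marginalCost g i (z i)) := by
        gcongr
        exact hg.map_single_le i (h i)
    _ = _ := by
        rw [NNReal.coe_mul, NNReal.coe_natCast]
        field_simp

/-- Jensen's inequality: `z` is the average of the `d` axis points `d zᵢ eᵢ`. -/
theorem IsConvexCost.le_separatedCost (hd : 0 < d) (hg : IsConvexCost g) (z : Fin d → ℝ≥0) :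
    g z ≤ separatedCost g z := by
  let f : (Fin d → ℝ) → ℝ := fun x => g fun i => (x i).toNNReal
  have hf : ConvexOn ℝ (Set.Ici 0) f := by
    refine ⟨convex_Ici 0, fun x hx y hy a b ha hb hab => ?_⟩
    have h := hg.2.2.2 (Set.mem_univ fun i => (x i).toNNReal) (Set.mem_univ fun i => (y i).toNNReal)
      (zero_le (a := a.toNNReal)) (zero_le (a := b.toNNReal))
      (by rw [← Real.toNNReal_add ha hb, hab, Real.toNNReal_one])
    have e : (fun i => ((a • x + b • y) i).toNNReal) =
        a.toNNReal • (fun i => (x i).toNNReal) + b.toNNReal • (fun i => (y i).toNNReal) := by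
      funext i
      have hxi : 0 ≤ x i := hx i
      have hyi : 0 ≤ y i := hy i
      simp only [Pi.add_apply, Pi.smul_apply, smul_eq_mul]
      rw [Real.toNNReal_add (mul_nonneg ha hxi) (mul_nonneg hb hyi), Real.toNNReal_mul ha,
        Real.toNNReal_mul hb]
    show (g _ : ℝ) ≤ a • (g _ : ℝ) + b • (g _ : ℝ)
    rw [e]
    have h' := NNReal.coe_le_coe.2 h
    simpa [Real.coe_toNNReal _ ha, Real.coe_toNNReal _ hb] using h'
  have hd' : (d : ℝ) ≠ 0 := by exact_mod_cast hd.ne'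
  have h := hf.map_sum_le (t := Finset.univ) (w := fun _ : Fin d => (d : ℝ)⁻¹)
    (p := fun i => Pi.single i (d * z i : ℝ)) (fun _ _ => by positivity) (by simp [hd'])
    (fun i _ => by
      rw [Set.mem_Ici, Pi.single_nonneg]
      positivity)
  have e1 : ∑ i, (d : ℝ)⁻¹ • (Pi.single i (d * z i : ℝ) : Fin d → ℝ) = fun i => (z i : ℝ) := by
    rw [← Finset.univ_sum_single (fun i => (z i : ℝ))]
    refine Finset.sum_congr rfl fun i _ => ?_
    rw [← Pi.single_smul, smul_eq_mul, inv_mul_cancel_left₀ hd']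
  have e2 : ∀ i : Fin d, f (Pi.single i (d * z i : ℝ)) = marginalCost g i (d * z i) := by
    intro i
    have : (fun j => ((Pi.single i (d * z i : ℝ) : Fin d → ℝ) j).toNNReal) =
        Pi.single i ((d : ℝ≥0) * z i) := by
      funext j
      rcases eq_or_ne j i with rfl | hj
      · simp [Real.toNNReal_mul]
      · simp [hj]
    simp only [f, this, marginalCost]
  simp only [e1, e2] at h
  have e3 : f (fun i => (z i : ℝ)) = g z := by simp [f]
  rw [e3] at h
  rw [← NNReal.coe_le_coe]
  simpa [separatedCost, Finset.mul_sum] using h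

theorem IsConvexCost.separatedCost (hg : IsConvexCost g) : IsConvexCost (separatedCost g) := by
  refine ⟨by simp [_root_.separatedCost, marginalCost, hg.1], fun x y hxy => ?_, convex_univ, ?_⟩
  · unfold _root_.separatedCost marginalCost
    gcongr with i
    apply hg.2.1
    gcongr
    exact hxy i
  · intro x _ y _ a b ha hb hab
    have : ∀ i, marginalCost g i (d * (a • x + b • y) i) ≤
        a * marginalCost g i (d * x i) + b * marginalCost g i (d * y i) := by
      intro i
      have h := hg.2.2.2 (Set.mem_univ (Pi.single i (d * x i))) (Set.mem_univ (Pi.single i (d * y i)))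
        ha hb hab
      rw [← Pi.single_smul, ← Pi.single_smul, ← Pi.single_add] at h
      have e : (d : ℝ≥0) * (a • x + b • y) i = a • (d * x i) + b • (d * y i) := by
        simp only [Pi.add_apply, Pi.smul_apply, smul_eq_mul]
        ring
      rw [e]
      exact h
    unfold _root_.separatedCost
    calc (d : ℝ≥0)⁻¹ * ∑ i, marginalCost g i (d * (a • x + b • y) i)
        ≤ (d : ℝ≥0)⁻¹ * ∑ i, (a * marginalCost g i (d * x i) + b * marginalCost g i (d * y i)) := by
          gcongr with i
          exact this i
      _ = _ := by
          rw [Finset.sum_add_distrib, ← Finset.mul_sum, ← Finset.mul_sum, smul_eq_mul, smul_eq_mul]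
          ring

theorem isSeparableCost_separatedCost : IsSeparableCost (separatedCost g) :=
  ⟨fun i x => (d : ℝ)⁻¹ * marginalCost g i (d * x), fun z => by
    simp [separatedCost, Finset.mul_sum]⟩

/-- The sum of the larger of the secant cost and the individual cost over the parts of `z` is at
most the cost of `z`. -/
theorem IsConvexCost.sum_max_secantCost_le (hg : IsConvexCost g) (hs : IsSupermodularCost g)
    {ι : Type*} (B : Finset ι) (x : ι → Fin d → ℝ≥0) :
    ∑ e ∈ B, max (secantCost g (∑ e ∈ B, x e) (x e)) (g (x e)) ≤ g (∑ e ∈ B, x e) := by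
  classical
  set z := ∑ e ∈ B, x e with hz
  -- Items whose own cost dominates form the base, bounded by superadditivity; the others are added
  -- on top at their secant price.
  have hsplit := Finset.sum_filter_add_sum_filter_not B (fun e => secantCost g z (x e) ≤ g (x e)) x
  have h := hg.add_secantCost_le hs (∑ e ∈ B with secantCost g z (x e) ≤ g (x e), x e)
    (∑ e ∈ B with ¬ secantCost g z (x e) ≤ g (x e), x e)
  rw [hsplit, ← hz, secantCost_sum] at h
  have h2 := hg.sum_le_map_sum hs (B.filter fun e => secantCost g z (x e) ≤ g (x e)) x
  rw [← Finset.sum_filter_add_sum_filter_not B (fun e => secantCost g z (x e) ≤ g (x e))]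
  have e1 : ∑ e ∈ B with secantCost g z (x e) ≤ g (x e), max (secantCost g z (x e)) (g (x e) : ℝ) =
      ∑ e ∈ B with secantCost g z (x e) ≤ g (x e), (g (x e) : ℝ) :=
    Finset.sum_congr rfl fun e he => max_eq_right (Finset.mem_filter.1 he).2
  have e2 : ∑ e ∈ B with ¬ secantCost g z (x e) ≤ g (x e),
        max (secantCost g z (x e)) (g (x e) : ℝ) =
      ∑ e ∈ B with ¬ secantCost g z (x e) ≤ g (x e), secantCost g z (x e) :=
    Finset.sum_congr rfl fun e he => max_eq_left (not_le.1 (Finset.mem_filter.1 he).2).le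
  rw [e1, e2]
  linarith

end Cost

/-! ### Balanced splitting by Carathéodory's theorem -/

/-- Items with nonnegative `m`-dimensional sizes can be split into `k` parts, each of at most a `1/k`
fraction of the total size in every dimension, after setting aside at most `k * m + 1` items. -/
theorem exists_balanced_coloring {ι : Type*} [Fintype ι] {m k : ℕ} (hk : 0 < k)
    (x : ι → Fin m → ℝ) (hx : ∀ e i, 0 ≤ x e i) :
    ∃ c : ι → Option (Fin k), (Finset.univ.filter fun e => c e = none).card ≤ k * m + 1 ∧
      ∀ j i, (k : ℝ) * ∑ e with c e = some j, x e i ≤ ∑ e, x e i := by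
  classical
  rcases isEmpty_or_nonempty ι with hι | hι
  · exact ⟨fun _ => none, by simp, by simp⟩
  -- The point `q (e, j)` records that item `e` gets colour `j`: a unit in slot `e`, and the size of
  -- `e` in row `j`. The average of all these points is the uniform fractional colouring.
  let q : ι × Fin k → (ι → ℝ) × (Fin k → Fin m → ℝ) := fun p =>
    (Pi.single p.1 1, Pi.single p.2 (x p.1))
  set n : ℝ := (Fintype.card ι : ℝ) with hn
  have hn0 : 0 < n := by simpa [hn] using Fintype.card_pos
  have hk0 : (0 : ℝ) < k := by exact_mod_cast hk
  have hmem : ∑ p : ι × Fin k, (n * k)⁻¹ • q p ∈ convexHull ℝ (Set.range q) :=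
    (convex_convexHull ℝ _).sum_mem (fun _ _ => by positivity)
      (by simp only [Finset.sum_const, Finset.card_univ, Fintype.card_prod, Fintype.card_fin,
            nsmul_eq_mul, Nat.cast_mul, ← hn]
          field_simp)
      (fun p _ => subset_convexHull ℝ _ ⟨p, rfl⟩)
  -- Carathéodory keeps the item weights and the colour loads, but uses at most `card ι + k * m + 1`
  -- item-colour pairs.
  obtain ⟨α, _, z, w, hz, hind, hw, hw1, hsum⟩ := eq_pos_convex_span_of_mem_convexHull hmem
  have hcard : Fintype.card α ≤ Fintype.card ι + k * m + 1 := by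
    refine hind.card_le_finrank_succ.trans (Nat.succ_le_succ ?_)
    refine (Submodule.finrank_le _).trans ?_
    simp [Module.finrank_prod, Module.finrank_pi_fintype]
  choose r hr using fun a => hz ⟨a, rfl⟩
  simp only [← hr] at hsum
  have h1 : ∀ e, ∑ a with (r a).1 = e, w a = n⁻¹ := by
    intro e
    have h := congrFun (congrArg Prod.fst hsum) e
    have hq : ∀ p : ι × Fin k, (Pi.single p.1 1 : ι → ℝ) e = if p.1 = e then 1 else 0 := by
      intro p
      by_cases hp : p.1 = e
      · subst hp; simp
      · simp [hp]
    simp only [q, Prod.fst_sum, Prod.smul_fst, Finset.sum_apply, Pi.smul_apply, hq,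
      smul_eq_mul, mul_ite, mul_one, mul_zero] at h
    simp only [Fintype.sum_prod_type_right, Finset.sum_ite_eq', Finset.mem_univ, if_true,
      Finset.sum_const, Finset.card_univ, Fintype.card_fin, nsmul_eq_mul] at h
    rw [Finset.sum_filter, h]
    field_simp
  have h2 : ∀ j i, ∑ a with (r a).2 = j, w a * x (r a).1 i = (n * k)⁻¹ * ∑ e, x e i := by
    intro j i
    have h := congrFun (congrFun (congrArg Prod.snd hsum) j) i
    have hq : ∀ p : ι × Fin k, (Pi.single p.2 (x p.1) : Fin k → Fin m → ℝ) j i =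
        if p.2 = j then x p.1 i else 0 := by
      intro p
      by_cases hp : p.2 = j
      · subst hp; simp
      · simp [hp]
    simp only [q, Prod.snd_sum, Prod.smul_snd, Finset.sum_apply, Pi.smul_apply, hq,
      smul_eq_mul, mul_ite, mul_zero] at h
    simp only [Fintype.sum_prod_type, Finset.sum_ite_eq', Finset.mem_univ, if_true] at h
    rw [Finset.sum_filter, h, Finset.mul_sum]
  have hpos : ∀ e, 0 < (Finset.univ.filter fun a => (r a).1 = e).card := by
    intro e
    rw [Finset.card_pos]
    by_contra hne
    rw [Finset.not_nonempty_iff_eq_empty] at hne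
    have := h1 e
    rw [hne, Finset.sum_empty] at this
    exact (inv_pos.2 hn0).ne this
  choose a₀ ha₀ using fun e => Finset.card_pos.1 (hpos e)
  refine ⟨fun e => if (Finset.univ.filter fun a => (r a).1 = e).card = 1 then some (r (a₀ e)).2
    else none, ?_, fun j i => ?_⟩
  · have hfib : Fintype.card α = ∑ e, (Finset.univ.filter fun a => (r a).1 = e).card :=
      Finset.card_eq_sum_card_fiberwise (f := fun a => (r a).1) (fun _ _ => Finset.mem_univ _)
    -- Every item occurs in some pair, so at most `k * m + 1` items occur more than once; these are
    -- the ones set aside.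
    have : ∑ e : ι, (1 + if (Finset.univ.filter fun a => (r a).1 = e).card = 1 then 0 else 1) ≤
        ∑ e, (Finset.univ.filter fun a => (r a).1 = e).card := by
      refine Finset.sum_le_sum fun e _ => ?_
      have := hpos e
      split_ifs <;> omega
    rw [Finset.sum_add_distrib, Finset.sum_const, Finset.card_univ, smul_eq_mul, mul_one, ← hfib]
      at this
    have hF : (Finset.univ.filter fun e : ι => (if (Finset.univ.filter fun a => (r a).1 = e).card = 1
        then some (r (a₀ e)).2 else none) = none).card =
        ∑ e : ι, if (Finset.univ.filter fun a => (r a).1 = e).card = 1 then 0 else 1 := by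
      rw [Finset.card_filter]
      refine Finset.sum_congr rfl fun e _ => ?_
      split_ifs <;> simp_all
    rw [hF]
    omega
  -- An item with a single pair carries its full weight `n⁻¹` on one colour, so rounding only drops
  -- load.
  · have key : n⁻¹ * ∑ e with (if (Finset.univ.filter fun a => (r a).1 = e).card = 1
        then some (r (a₀ e)).2 else none) = some j, x e i ≤ (n * k)⁻¹ * ∑ e, x e i := by
      rw [← h2 j i, Finset.sum_filter, Finset.mul_sum, Finset.sum_filter,
        ← Finset.sum_fiberwise (g := fun a => (r a).1) (s := Finset.univ)]
      refine Finset.sum_le_sum fun e _ => ?_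
      have hnn : ∀ a ∈ Finset.univ.filter fun a => (r a).1 = e,
          0 ≤ if (r a).2 = j then w a * x (r a).1 i else 0 := fun a _ => by
        split_ifs
        · exact mul_nonneg (hw a).le (hx _ _)
        · exact le_rfl
      by_cases hc : (Finset.univ.filter fun a => (r a).1 = e).card = 1
      · by_cases hj : (r (a₀ e)).2 = j
        · have hs : (Finset.univ.filter fun a => (r a).1 = e) = {a₀ e} := by
            obtain ⟨b, hb⟩ := Finset.card_eq_one.1 hc
            have := ha₀ e
            rw [hb, Finset.mem_singleton] at this
            rw [hb, this]
          have hwa := h1 e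
          rw [hs, Finset.sum_singleton] at hwa
          have hre : (r (a₀ e)).1 = e := (Finset.mem_filter.1 (ha₀ e)).2
          simp [hs, hj, hwa, hre]
        · simpa [hc, hj] using Finset.sum_nonneg hnn
      · simpa [hc] using Finset.sum_nonneg hnn
    rw [mul_inv, mul_assoc] at key
    have := le_of_mul_le_mul_left key (inv_pos.2 hn0)
    rwa [← div_eq_inv_mul, le_div_iff₀' hk0] at this

/-! ### Decomposition of the profit -/

theorem IsSubmodularValue.biUnion_le {U : Type*} [DecidableEq U] {v : Finset U → ℝ}
    (hv : IsSubmodularValue v) {ι : Type*} (s : Finset ι) (f : ι → Finset U)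
    (hf : (s : Set ι).PairwiseDisjoint f) : v (s.biUnion f) ≤ ∑ i ∈ s, v (f i) := by
  classical
  induction s using Finset.induction_on with
  | empty => simp [hv.1]
  | insert i s hi ih =>
    rw [Finset.biUnion_insert, Finset.sum_insert hi]
    have h := hv.2 (f i) (s.biUnion f)
    have hdisj : f i ∩ s.biUnion f = ∅ := by
      rw [← Finset.disjoint_iff_inter_eq_empty, Finset.disjoint_biUnion_right]
      exact fun j hj => hf (by simp) (by simp [hj]) (ne_of_mem_of_not_mem hj hi).symm
    rw [hdisj, hv.1, add_zero] at h
    linarith [ih (hf.subset (by simp))]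

/-- The profit of a set is controlled by the separable profits of its subsets and the profits of its
items. -/
theorem ProfitInstance.profit_le_of_separated {U : Type*} [Fintype U] [DecidableEq U] {d : ℕ}
    (hd : 0 < d) (I : ProfitInstance U d) (hv : IsSubmodularValue I.value)
    (hg : IsConvexCost I.cost) (hs : IsSupermodularCost I.cost) (B : Finset U) {p m : ℝ}
    (hm0 : 0 ≤ m) (hp : ∀ X ⊆ B, I.separated.profit X ≤ p) (hm : ∀ e ∈ B, I.profit {e} ≤ m) :
    I.profit B ≤ d * p + (d * d + 1) * m := by
  set z := ∑ e ∈ B, I.size e with hz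
  -- With `d` colours and `d` dimensions, at most `d * d + 1` items are set aside. Items outside `B`
  -- get size 0.
  obtain ⟨c, hc, hload⟩ := exists_balanced_coloring hd
    (fun e i => if e ∈ B then (I.size e i : ℝ) else 0) (fun e i => by positivity)
  set ℓ : U → ℝ := fun e => max (secantCost I.cost z (I.size e)) (I.cost (I.size e)) with hℓ
  set X : Option (Fin d) → Finset U := fun o => B.filter fun e => c e = o with hX
  have hcost : ∑ e ∈ B, ℓ e ≤ I.cost z := hg.sum_max_secantCost_le hs B I.size
  have hpart : ∀ j, I.value (X (some j)) - ∑ e ∈ X (some j), ℓ e ≤ p := by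
    intro j
    refine le_trans ?_ (hp (X (some j)) (Finset.filter_subset _ _))
    have h1 : ∀ i, (d : ℝ≥0) * (∑ e ∈ X (some j), I.size e) i ≤ z i := by
      intro i
      have h := hload j i
      rw [Finset.sum_ite_mem, Finset.filter_inter, Finset.univ_inter, Finset.sum_ite_mem,
        Finset.univ_inter] at h
      rw [← NNReal.coe_le_coe]
      simpa [hz, hX] using h
    have h2 := hg.separatedCost_le_secantCost hd h1
    rw [secantCost_sum] at h2
    have h3 : ∑ e ∈ X (some j), secantCost I.cost z (I.size e) ≤ ∑ e ∈ X (some j), ℓ e :=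
      Finset.sum_le_sum fun e _ => le_max_left _ _
    show _ ≤ I.value (X (some j)) - (separatedCost I.cost (∑ e ∈ X (some j), I.size e) : ℝ)
    linarith
  have hsingle : ∀ e ∈ X none, I.value {e} - ℓ e ≤ m := by
    intro e he
    refine le_trans ?_ (hm e (Finset.filter_subset _ _ he))
    simp only [ProfitInstance.profit, Finset.sum_singleton]
    linarith [le_max_right (secantCost I.cost z (I.size e)) (I.cost (I.size e) : ℝ)]
  have hdisj : ∀ s : Set (Option (Fin d)), s.PairwiseDisjoint X := fun s o _ o' _ hne =>
    Finset.disjoint_filter.2 fun e _ h h' => hne (h.symm.trans h')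
  have hBX : B = Finset.univ.biUnion X := by
    ext e
    simp [hX]
  have hval : I.value B ≤ I.value (X none) + ∑ j, I.value (X (some j)) := by
    conv_lhs => rw [hBX]
    refine (hv.biUnion_le Finset.univ X (hdisj _)).trans_eq ?_
    rw [Fintype.sum_option]
  have hnone : I.value (X none) ≤ ∑ e ∈ X none, I.value {e} := by
    have h := hv.biUnion_le (X none) (fun e => {e}) (fun a _ b _ hab => by simpa using hab)
    rwa [Finset.biUnion_singleton_eq_self] at h
  have hℓB : ∑ e ∈ B, ℓ e = ∑ e ∈ X none, ℓ e + ∑ j, ∑ e ∈ X (some j), ℓ e := by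
    rw [← Fintype.sum_option (fun o => ∑ e ∈ X o, ℓ e)]
    exact (Finset.sum_fiberwise B c ℓ).symm
  have hcard : ((X none).card : ℝ) ≤ d * d + 1 := by
    have : (X none).card ≤ d * d + 1 :=
      (Finset.card_le_card (Finset.filter_subset_filter _ (Finset.subset_univ B))).trans hc
    exact_mod_cast this
  have hs1 := Finset.sum_le_sum hsingle
  rw [Finset.sum_sub_distrib, Finset.sum_const, nsmul_eq_mul] at hs1
  have hs2 := Finset.sum_le_sum fun j (_ : j ∈ Finset.univ) => hpart j
  rw [Finset.sum_sub_distrib, Finset.sum_const, Finset.card_univ, Fintype.card_fin,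
    nsmul_eq_mul] at hs2
  have hs3 := mul_le_mul_of_nonneg_right hcard hm0
  show I.value B - (I.cost z : ℝ) ≤ _
  linarith

/-! ### Analysis of the randomized reduction -/

namespace OnlineAlgorithm

variable {U : Type*} [Fintype U] [DecidableEq U] {M : Matroid U} {d : ℕ}

theorem expectedProfit_mix (q : unitInterval) (A B : OnlineAlgorithm M d)
    (I : ProfitInstance U d) :
    (mix q A B).expectedProfit I = q * A.expectedProfit I + (1 - q) * B.expectedProfit I := by
  have key : ∀ σ, ∫ ω, I.profit ((mix q A B).select ω I σ) ∂(mix q A B).μ =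
      q * ∫ ω, I.profit (A.select ω I σ) ∂A.μ + (1 - q) * ∫ ω, I.profit (B.select ω I σ) ∂B.μ := by
    intro σ
    let F : A.Ω ⊕ B.Ω → ℝ := fun ω => I.profit ((mix q A B).select ω I σ)
    have hint : Integrable F
        (ENNReal.ofReal q • A.μ.map Sum.inl + ENNReal.ofReal (1 - q) • B.μ.map Sum.inr) :=
      (mix q A B).integrable_select I σ I.profit
    rw [integrable_add_measure] at hint
    have hl : MeasurableEmbedding (Sum.inl : A.Ω → A.Ω ⊕ B.Ω) :=
      ⟨Sum.inl_injective, measurable_inl, fun _ h => h.inl_image⟩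
    have hr : MeasurableEmbedding (Sum.inr : B.Ω → A.Ω ⊕ B.Ω) :=
      ⟨Sum.inr_injective, measurable_inr, fun _ h => h.inr_image⟩
    refine (integral_add_measure hint.1 hint.2).trans ?_
    rw [integral_smul_measure, integral_smul_measure,
      hl.integral_map F, hr.integral_map F,
      ENNReal.toReal_ofReal q.2.1, ENNReal.toReal_ofReal (sub_nonneg.2 q.2.2)]
    rfl
  unfold expectedProfit
  simp only [key, Finset.sum_add_distrib, ← Finset.mul_sum]
  ring

theorem expectedProfit_mono (A B : OnlineAlgorithm M d) (I J : ProfitInstance U d)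
    (h : ∀ σ, ∫ ω, I.profit (A.select ω I σ) ∂A.μ ≤ ∫ ω, J.profit (B.select ω J σ) ∂B.μ) :
    A.expectedProfit I ≤ B.expectedProfit J :=
  div_le_div_of_nonneg_right (Finset.sum_le_sum fun σ _ => h σ) (Nat.cast_nonneg _)

theorem expectedProfit_separated_le (hd : 0 < d) (A : OnlineAlgorithm M d) (I : ProfitInstance U d)
    (hg : IsConvexCost I.cost) :
    A.expectedProfit I.separated ≤ A.onSeparated.expectedProfit I := by
  refine expectedProfit_mono _ _ _ _ fun σ => integral_mono (A.integrable_select _ σ _)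
    (A.integrable_select I.separated σ I.profit) fun ω => ?_
  exact sub_le_sub_left (NNReal.coe_le_coe.2 (hg.le_separatedCost hd _)) _

/-- The decomposition applies with `p` equal to `β` times the surrogate profit of `A` and `m` equal
to `e` times the profit of `S`. Subsets of `B` are independent, so both guarantees cover every
piece. -/
theorem reduction_isApproximation (hd : 0 < d) {𝒱 : Set (Finset U → ℝ)}
    (h𝒱 : ∀ v ∈ 𝒱, IsSubmodularValue v) (β : ℝ) (hβ : 0 < β) (A S : OnlineAlgorithm M d)
    (hA : A.IsApproximation β (separableInstances d 𝒱))
    (hS : S.IsSingleSecretary (supermodularInstances d 𝒱)) :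
    (reduction β hβ A S).IsApproximation ((d : ℝ) * (β + 2 * Real.exp 1 * (d : ℝ)))
      (supermodularInstances d 𝒱) := by
  intro I hI B hB
  obtain ⟨hv, hg, hs⟩ := hI
  have he := Real.exp_pos 1
  have hd1 : (1 : ℝ) ≤ d := by exact_mod_cast hd
  have hsep : I.separated ∈ separableInstances d 𝒱 :=
    ⟨hv, hg.separatedCost, isSeparableCost_separatedCost⟩
  have hsub : ∀ X ⊆ B, M.Indep (X : Set U) := fun X hX => hB.subset (by exact_mod_cast hX)
  have hS' : ∀ C ⊆ B, C.card ≤ 1 → I.profit C ≤ Real.exp 1 * S.expectedProfit I := by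
    intro C hC hC1
    have h := hS.2 I ⟨hv, hg, hs⟩ C (hsub C hC) hC1
    rwa [← div_eq_inv_mul, div_le_iff₀' he] at h
  have hS0 : 0 ≤ Real.exp 1 * S.expectedProfit I := by
    have h := hS' ∅ (Finset.empty_subset _) (by simp)
    simpa [ProfitInstance.profit, (h𝒱 _ hv).1, hg.1] using h
  have hmain := I.profit_le_of_separated hd (h𝒱 _ hv) hg hs B hS0
    (fun X hX => hA _ hsep X (hsub X hX))
    (fun e he => hS' {e} (Finset.singleton_subset_iff.2 he) (by simp))
  have hA' := expectedProfit_separated_le hd A I hg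
  have hmix : (β + 2 * Real.exp 1 * d) * (reduction β hβ A S).expectedProfit I =
      β * A.onSeparated.expectedProfit I + 2 * Real.exp 1 * d * S.expectedProfit I := by
    have hpos : β + 2 * Real.exp 1 * d ≠ 0 := by positivity
    unfold reduction
    rw [expectedProfit_mix]
    simp only [separableProb]
    field_simp
    ring
  rw [mul_assoc, hmix]
  have h1 : (d : ℝ) * (β * A.expectedProfit I.separated) ≤
      d * (β * A.onSeparated.expectedProfit I) := by gcongr
  -- As `1 ≤ d`, the count `d² + 1` is at most `2 d²`: the source of the factor 2 in the mixing
  -- weights.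
  have h2 : ((d : ℝ) * d + 1) * (Real.exp 1 * S.expectedProfit I) ≤
      (2 * (d * d)) * (Real.exp 1 * S.expectedProfit I) :=
    mul_le_mul_of_nonneg_right (by nlinarith) hS0
  linarith

end OnlineAlgorithm

/-! ### Length of the observation phase -/

theorem Real.log_div_add_le_sum_inv {k n : ℕ} (hk : 0 < k) (hkn : k ≤ n) :
    Real.log (n / k) + ((k : ℝ)⁻¹ - (n : ℝ)⁻¹) / 2 ≤ ∑ t ∈ Finset.Ico k n, (t : ℝ)⁻¹ := by
  induction n, hkn using Nat.le_induction with
  | base => simp [div_self (Nat.cast_ne_zero (R := ℝ).2 hk.ne')]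
  | succ n hkn ih =>
    have hn : (0 : ℝ) < n := by exact_mod_cast hk.trans_le hkn
    have hk' : (0 : ℝ) < k := by exact_mod_cast hk
    rw [Finset.sum_Ico_succ_top hkn]
    -- `u ≤ sinh u` at `u = log ((n + 1) / n)` is the trapezoid bound `log ((n + 1) / n) ≤ (1/n +
    -- 1/(n + 1)) / 2`.
    have h := Real.self_le_sinh_iff.2 (Real.log_nonneg (x := (n + 1) / n)
      ((one_le_div hn).2 (by linarith)))
    rw [Real.sinh_log (by positivity)] at h
    have e : ((n + 1 : ℕ) : ℝ) / k = (n / k) * ((n + 1) / n) := by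
      push_cast
      field_simp
    rw [e, Real.log_mul (by positivity) (by positivity)]
    have e2 : (((n : ℝ) + 1) / n - (((n : ℝ) + 1) / n)⁻¹) / 2 = ((n : ℝ)⁻¹ + ((n + 1 : ℕ) : ℝ)⁻¹) / 2 := by
      push_cast
      field_simp
      ring
    linarith

/-- The length of the observation phase for which the classical secretary rule succeeds with
probability at least `1 / e`. -/
theorem exists_secretary_threshold {n : ℕ} (hn : 2 ≤ n) :
    ∃ k, 0 < k ∧ k ≤ n ∧
      (Real.exp 1)⁻¹ ≤ (k : ℝ) / n * ∑ t ∈ Finset.Ico k n, (t : ℝ)⁻¹ := by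
  have he1 := Real.exp_one_gt_d9
  have he2 := Real.exp_one_lt_d9
  set E := Real.exp 1 with hE
  have hE0 : 0 < E := Real.exp_pos 1
  rcases hn.eq_or_lt with rfl | hn3
  · refine ⟨1, one_pos, by norm_num, ?_⟩
    have : E⁻¹ ≤ 1 / 2 := by
      rw [inv_le_comm₀ hE0 (by norm_num)]
      linarith
    simpa using this
  have hn0 : (3 : ℝ) ≤ n := by exact_mod_cast hn3
  set k := round ((n : ℝ) / E) with hk
  have hround : |(n : ℝ) / E - k| ≤ 1 / 2 := abs_sub_round _
  rw [abs_le] at hround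
  have h1 : 1 ≤ (n : ℝ) / E := by rw [le_div_iff₀ hE0]; linarith
  have hkpos : 0 < k := by
    have : (0 : ℝ) < k := by linarith
    exact_mod_cast this
  obtain ⟨m, hm⟩ := Int.eq_ofNat_of_zero_le hkpos.le
  have hkm : (k : ℝ) = m := by rw [hm]; simp
  rw [hkm] at hround
  have hm0 : 0 < m := by omega
  have hm0' : (0 : ℝ) < m := by exact_mod_cast hm0
  set x := (m : ℝ) / n with hx
  have hxpos : 0 < x := by positivity
  have hδ : |E * x - 1| ≤ E / (2 * n) := by
    have e : E * x - 1 = - (E / n) * (n / E - m) := by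
      rw [hx]
      field_simp
      ring
    rw [e, abs_mul, abs_neg, abs_of_pos (by positivity)]
    calc E / n * |n / E - m| ≤ E / n * (1 / 2) := by
          gcongr
          exact abs_le.2 hround
      _ = _ := by ring
  have hn1 : (1 : ℝ) / n ≤ 1 / 3 := one_div_le_one_div_of_le (by norm_num) hn0
  have hEx : E * x ≤ 1 + E / 6 := by
    have : E / (2 * n) ≤ E / 6 := by
      gcongr
      linarith
    linarith [(abs_le.1 hδ).2]
  have hx1 : x + E / (2 * n) ≤ 1 := by
    have h6 : E / (2 * n) ≤ E / 6 := by
      gcongr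
      linarith
    have : E * (x + E / 6) ≤ E * 1 := by nlinarith
    linarith [le_of_mul_le_mul_left this hE0]
  have hmn : m ≤ n := by
    have : x ≤ 1 := by linarith [show 0 ≤ E / (2 * n) by positivity]
    rw [hx, div_le_one (by linarith)] at this
    exact_mod_cast this
  refine ⟨m, hm0, hmn, ?_⟩
  have hlog : 2 - E * x ≤ Real.log (n / m) := by
    have h := Real.log_le_sub_one_of_pos (show 0 < E * x by positivity)
    rw [Real.log_mul hE0.ne' hxpos.ne', hE, Real.log_exp] at h
    have : Real.log (n / m) = - Real.log x := by rw [hx, ← Real.log_inv, inv_div]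
    rw [this]
    linarith
  have hsum := Real.log_div_add_le_sum_inv hm0 hmn
  have hinv : x * (((m : ℝ)⁻¹ - (n : ℝ)⁻¹) / 2) = (1 - x) / (2 * n) := by
    rw [hx]
    field_simp
  -- Rounding `n / E` costs at most `E / (4 n²)`. The trapezoid correction `(1 - x) / (2 n)` covers
  -- this by `hx1`.
  calc E⁻¹ ≤ x * (2 - E * x) + (1 - x) / (2 * n) := by
        have h2 : (E * x - 1) ^ 2 ≤ (E / (2 * n)) ^ 2 := sq_le_sq' (abs_le.1 hδ).1 (abs_le.1 hδ).2
        have e : x * (2 - E * x) = E⁻¹ - E⁻¹ * (E * x - 1) ^ 2 := by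
          field_simp
          ring
        have h3 : E⁻¹ * (E * x - 1) ^ 2 ≤ (1 - x) / (2 * n) := by
          calc E⁻¹ * (E * x - 1) ^ 2 ≤ E⁻¹ * (E / (2 * n)) ^ 2 := by gcongr
            _ = (E / (2 * n)) / (2 * n) := by field_simp
            _ ≤ _ := by
              gcongr
              linarith
        linarith
    _ ≤ x * (Real.log (n / m) + ((m : ℝ)⁻¹ - (n : ℝ)⁻¹) / 2) := by
        rw [mul_add, hinv]
        gcongr
    _ ≤ _ := by gcongr

/-! ### Counting arrival orders -/

section Counting

variable {U : Type*} [Fintype U] [DecidableEq U] {L : Type*} [LinearOrder L]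

/-- The arrival orders in which `e` arrives at time `t`, and the best of the items before is the one
that arrives at time `r`. -/
def leaderOrders (key : U → L) (e : U) (t r : Fin (Fintype.card U)) : Finset (ArrivalOrder U) :=
  Finset.univ.filter fun σ => σ t = e ∧ ∀ s < t, key (σ s) ≤ key (σ r)

theorem card_filter_arrival (e : U) (t : Fin (Fintype.card U)) :
    Fintype.card U * (Finset.univ.filter fun σ : ArrivalOrder U => σ t = e).card =
      Fintype.card (ArrivalOrder U) := by
  have hle : ∀ t t' : Fin (Fintype.card U),
      (Finset.univ.filter fun σ : ArrivalOrder U => σ t = e).card ≤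
      (Finset.univ.filter fun σ : ArrivalOrder U => σ t' = e).card := by
    intro t t'
    refine Finset.card_le_card_of_injOn (fun σ => (Equiv.swap t t').trans σ) ?_ ?_
    · intro σ hσ
      simpa using hσ
    · intro σ _ σ' _ h
      have := congrArg ((Equiv.swap t t').trans) h
      simpa [← Equiv.trans_assoc] using this
  have hsum : Fintype.card (ArrivalOrder U) =
      ∑ t', (Finset.univ.filter fun σ : ArrivalOrder U => σ t' = e).card := by
    rw [← Finset.card_univ, Finset.card_eq_sum_card_fiberwise (f := fun σ : ArrivalOrder U => σ.symm e)
      (t := Finset.univ) (fun _ _ => Finset.mem_univ _)]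
    refine Finset.sum_congr rfl fun t' _ => ?_
    congr 1
    ext σ
    simpa using σ.symm_apply_eq.trans eq_comm
  rw [hsum, Finset.sum_congr rfl fun t' _ => le_antisymm (hle t' t) (hle t t')]
  simp

/-- Swapping two times before `t` shows that each of the `t` positions is equally likely for the
best earlier item; injectivity of `key` makes these events disjoint. -/
theorem card_leaderOrders {key : U → L} (hkey : Function.Injective key) (e : U)
    {t r : Fin (Fintype.card U)} (hr : r < t) :
    (t : ℕ) * (leaderOrders key e t r).card =
      (Finset.univ.filter fun σ : ArrivalOrder U => σ t = e).card := by
  have hle : ∀ r < t, ∀ r' < t,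
      (leaderOrders key e t r).card ≤ (leaderOrders key e t r').card := by
    intro r hr r' hr'
    refine Finset.card_le_card_of_injOn (fun σ => (Equiv.swap r r').trans σ) ?_ ?_
    · intro σ hσ
      simp only [leaderOrders, Finset.coe_filter, Finset.mem_univ, true_and, Set.mem_ofPred_eq,
        Equiv.trans_apply, Equiv.swap_apply_right] at hσ ⊢
      refine ⟨by rw [Equiv.swap_apply_of_ne_of_ne hr.ne' hr'.ne']; exact hσ.1, fun s hs => hσ.2 _ ?_⟩
      rw [Equiv.swap_apply_def]
      split_ifs <;> assumption
    · intro σ _ σ' _ h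
      have := congrArg ((Equiv.swap r r').trans) h
      simpa [← Equiv.trans_assoc] using this
  have hunion : (Finset.univ.filter fun σ : ArrivalOrder U => σ t = e) =
      (Finset.Iio t).biUnion (leaderOrders key e t) := by
    ext σ
    simp only [leaderOrders, Finset.mem_filter, Finset.mem_univ, true_and, Finset.mem_biUnion,
      Finset.mem_Iio]
    refine ⟨fun h => ?_, fun ⟨_, _, h, _⟩ => h⟩
    obtain ⟨b, hb, hmax⟩ := Finset.exists_max_image (Finset.Iio t) (fun s => key (σ s))
      ⟨r, Finset.mem_Iio.2 hr⟩
    exact ⟨b, Finset.mem_Iio.1 hb, h, fun s hs => hmax s (Finset.mem_Iio.2 hs)⟩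
  rw [hunion, Finset.card_biUnion]
  · rw [Finset.sum_congr rfl fun r' hr' =>
      le_antisymm (hle r' (Finset.mem_Iio.1 hr') r hr) (hle r hr r' (Finset.mem_Iio.1 hr'))]
    simp
  · intro r hr r' hr' hne
    refine Finset.disjoint_left.2 fun σ h h' => hne ?_
    simp only [leaderOrders, Finset.mem_filter, Finset.mem_univ, true_and] at h h'
    exact σ.injective (hkey (le_antisymm (h'.2 r (Finset.mem_Iio.1 hr)) (h.2 r' (Finset.mem_Iio.1 hr'))))

/-- The secretary rule with an observation phase of length `k`, for arrivals of ranks `κ`, stops at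
the first time `t ≥ k` whose rank exceeds all ranks of the observation phase. -/
def SecretaryStops {n : ℕ} (k : ℕ) (κ : Fin n → L) (t : Fin n) : Prop :=
  k ≤ t ∧ (∀ r : Fin n, (r : ℕ) < k → κ r < κ t) ∧
    ∀ s < t, k ≤ s → ∃ r : Fin n, (r : ℕ) < k ∧ κ s < κ r

theorem SecretaryStops.unique {n k : ℕ} {κ : Fin n → L} {t t' : Fin n}
    (h : SecretaryStops k κ t) (h' : SecretaryStops k κ t') : t = t' := by
  have key : ∀ t t' : Fin n, SecretaryStops k κ t → SecretaryStops k κ t' → t ≤ t' := by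
    intro t t' h h'
    by_contra! hlt
    obtain ⟨r, hr, hrt⟩ := h.2.2 t' hlt h'.1
    exact lt_asymm hrt (h'.2.1 r hr)
  exact le_antisymm (key t t' h h') (key t' t h' h)

theorem SecretaryStops.congr {n k : ℕ} {κ κ' : Fin n → L} {t : Fin n}
    (hκ : ∀ i ≤ t, κ i = κ' i) (h : SecretaryStops k κ t) : SecretaryStops k κ' t := by
  obtain ⟨hk, h1, h2⟩ := h
  have hlt : ∀ r : Fin n, (r : ℕ) < k → r ≤ t := fun r hr => Fin.le_def.2 (hr.le.trans hk)
  refine ⟨hk, fun r hr => ?_, fun s hs hks => ?_⟩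
  · rw [← hκ r (hlt r hr), ← hκ t le_rfl]
    exact h1 r hr
  · obtain ⟨r, hr, hsr⟩ := h2 s hs hks
    exact ⟨r, hr, by rwa [← hκ r (hlt r hr), ← hκ s hs.le]⟩

open Classical in
-- The best item `e` is selected if it arrives at some `t ≥ k` and the best earlier item arrives
-- before `k`. These events are disjoint over pairs of times, each of probability `1 / (n t)`. The
-- length `k` is chosen before the ranks, as an online rule requires.
theorem exists_secretaryStops_card (U : Type*) [Fintype U] [DecidableEq U] :
    ∃ k : ℕ, ∀ {L : Type} [LinearOrder L] (key : U → L), Function.Injective key →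
      ∀ e : U, (∀ e', key e' ≤ key e) →
        (Real.exp 1)⁻¹ * Fintype.card (ArrivalOrder U) ≤
          (Finset.univ.filter fun σ : ArrivalOrder U =>
            SecretaryStops k (key ∘ σ) (σ.symm e)).card := by
  set n := Fintype.card U with hn
  rcases lt_or_ge n 2 with hn2 | hn2
  -- With at most one item there is nothing to observe, and the rule takes the first arrival.
  · refine ⟨0, fun key _ e _ => ?_⟩
    have hsub : Subsingleton (Fin (Fintype.card U)) := by
      rw [← hn]
      exact Fin.subsingleton_iff_le_one.2 (by omega)
    rw [Finset.filter_true_of_mem, Finset.card_univ]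
    · refine mul_le_of_le_one_left (Nat.cast_nonneg _) (inv_le_one_of_one_le₀ ?_)
      exact Real.one_le_exp zero_le_one
    · refine fun σ _ => ⟨Nat.zero_le _, by simp, fun s hs => ?_⟩
      exact absurd (Subsingleton.elim _ _) hs.ne
  obtain ⟨k, hk0, hkn, hk⟩ := exists_secretary_threshold hn2
  refine ⟨k, fun key hkey e he => ?_⟩
  set C : ℝ := (Fintype.card (ArrivalOrder U) : ℝ) with hC
  have hn0 : (0 : ℝ) < n := by exact_mod_cast (by omega : 0 < n)
  let P : Finset (Fin n × Fin n) := Finset.univ.filter fun p => k ≤ p.1 ∧ (p.2 : ℕ) < k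
  have hlt : ∀ p ∈ P, p.2 < p.1 := fun p hp => by
    have := (Finset.mem_filter.1 hp).2
    exact Fin.lt_def.2 (this.2.trans_le this.1)
  have hcardE : ∀ p ∈ P, ((leaderOrders key e p.1 p.2).card : ℝ) = C / n * ((p.1 : ℕ) : ℝ)⁻¹ := by
    intro p hp
    have h1 := card_leaderOrders hkey e (hlt p hp)
    have h2 : n * _ = _ := card_filter_arrival e p.1
    rw [← h1] at h2
    have hp0 : (0 : ℝ) < (p.1 : ℕ) := by
      exact_mod_cast (Nat.zero_le _).trans_lt (Fin.lt_def.1 (hlt p hp))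
    rw [hC, ← h2, Nat.cast_mul, Nat.cast_mul]
    field_simp
  have hsub : P.biUnion (fun p => leaderOrders key e p.1 p.2) ⊆
      Finset.univ.filter fun σ : ArrivalOrder U => SecretaryStops k (key ∘ σ) (σ.symm e) := by
    intro σ hσ
    obtain ⟨p, hp, hσp⟩ := Finset.mem_biUnion.1 hσ
    obtain ⟨hp1, hp2⟩ := (Finset.mem_filter.1 hp).2
    obtain ⟨rfl, hmax⟩ := (Finset.mem_filter.1 hσp).2
    refine Finset.mem_filter.2 ⟨Finset.mem_univ _, ?_⟩
    rw [Equiv.symm_apply_apply]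
    refine ⟨hp1, fun r hr => lt_of_le_of_ne (he _) fun h => ?_, fun s hs hks => ⟨p.2, hp2, ?_⟩⟩
    · have := σ.injective (hkey h)
      rw [this] at hr
      omega
    · refine lt_of_le_of_ne (hmax s hs) fun h => ?_
      have := σ.injective (hkey h)
      rw [this] at hks
      omega
  have hdisj : (P : Set (Fin n × Fin n)).PairwiseDisjoint fun p => leaderOrders key e p.1 p.2 := by
    intro p hp p' hp' hne
    refine Finset.disjoint_left.2 fun σ h h' => hne ?_
    obtain ⟨h1, h2⟩ := (Finset.mem_filter.1 h).2
    obtain ⟨h1', h2'⟩ := (Finset.mem_filter.1 h').2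
    have ht : p.1 = p'.1 := σ.injective (h1.trans h1'.symm)
    have hp1 := hlt p hp
    have hp1' := hlt p' hp'
    rw [← ht] at hp1' h2'
    exact Prod.ext ht (σ.injective (hkey (le_antisymm (h2' _ hp1) (h2 _ hp1'))))
  have hcount : ∑ p ∈ P, C / n * ((p.1 : ℕ) : ℝ)⁻¹ =
      C * ((k : ℝ) / n * ∑ t ∈ Finset.Ico k n, (t : ℝ)⁻¹) := by
    have hP : P = (Finset.univ.filter fun t : Fin n => k ≤ t) ×ˢ
        (Finset.univ.filter fun r : Fin n => (r : ℕ) < k) := by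
      ext p
      simp [P]
    have hcardk : (Finset.univ.filter fun r : Fin n => (r : ℕ) < k).card = k := by
      rw [Fin.card_filter_val_lt]
      exact min_eq_right hkn
    have hIco : ∑ t ∈ (Finset.univ : Finset (Fin n)).filter (fun t : Fin n => k ≤ (t : ℕ)), ((t : ℕ) : ℝ)⁻¹ =
        ∑ t ∈ Finset.Ico k n, (t : ℝ)⁻¹ := by
      rw [Finset.sum_filter, Fin.sum_univ_eq_sum_range (fun t => if k ≤ t then (t : ℝ)⁻¹ else 0),
        ← Finset.sum_filter]
      congr 1
      ext t
      simp [and_comm]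
    rw [← Finset.mul_sum, hP, Finset.sum_product]
    simp only [Finset.sum_const, hcardk, nsmul_eq_mul]
    rw [← Finset.mul_sum, hIco]
    ring
  calc (Real.exp 1)⁻¹ * C ≤ C * ((k : ℝ) / n * ∑ t ∈ Finset.Ico k n, (t : ℝ)⁻¹) := by
        rw [mul_comm]
        gcongr
    _ = ((P.biUnion fun p => leaderOrders key e p.1 p.2).card : ℝ) := by
        rw [Finset.card_biUnion fun p hp p' hp' hne => hdisj hp hp' hne, Nat.cast_sum,
          Finset.sum_congr rfl hcardE, hcount]
    _ ≤ _ := by exact_mod_cast Finset.card_le_card hsub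

end Counting

/-! ### The single-item secretary algorithm -/

section Secretary

variable {U : Type*} {d : ℕ}

open Classical in
/-- The positive part of the profit of a single feasible item. -/
noncomputable def ProfitInstance.gain (M : Matroid U) (I : ProfitInstance U d) (e : U) : ℝ :=
  if M.Indep {e} then max 0 (I.profit {e}) else 0

/-- The gain of an item, with ties broken by a fixed enumeration of the items. -/
noncomputable def ProfitInstance.rank [Fintype U] (M : Matroid U) (I : ProfitInstance U d) (e : U) :
    ℝ ×ₗ Fin (Fintype.card U) :=
  toLex (I.gain M e, Fintype.equivFin U e)

theorem ProfitInstance.rank_injective [Fintype U] (M : Matroid U) (I : ProfitInstance U d) :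
    Function.Injective (I.rank M) := fun _ _ h =>
  (Fintype.equivFin U).injective (congrArg (fun p => (ofLex p).2) h)

theorem ProfitInstance.AgreeOn.gain_eq {I J : ProfitInstance U d} {X : Set U} (h : I.AgreeOn J X)
    (M : Matroid U) {e : U} (he : e ∈ X) : I.gain M e = J.gain M e := by
  have : I.profit {e} = J.profit {e} := by
    simp only [ProfitInstance.profit, Finset.sum_singleton, h.1, h.2.1 e he,
      h.2.2 {e} (by simpa using he)]
  unfold ProfitInstance.gain
  rw [this]

theorem ProfitInstance.indep_of_gain_pos {M : Matroid U} {I : ProfitInstance U d} {e : U}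
    (h : 0 < I.gain M e) : M.Indep {e} := by
  by_contra hne
  simp [ProfitInstance.gain, hne] at h

theorem ProfitInstance.profit_eq_gain {M : Matroid U} {I : ProfitInstance U d} {e : U}
    (h : 0 < I.gain M e) : I.profit {e} = I.gain M e := by
  have hi := ProfitInstance.indep_of_gain_pos h
  simp only [ProfitInstance.gain, hi, if_true] at h ⊢
  exact (max_eq_right_of_lt ((lt_max_iff.1 h).resolve_left (lt_irrefl _))).symm

variable [Fintype U]

open Classical in
/-- The item accepted by the secretary rule, provided that its gain is positive. -/
noncomputable def secretarySelect (M : Matroid U) (k : ℕ) (I : ProfitInstance U d)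
    (σ : ArrivalOrder U) : Finset U :=
  Finset.univ.filter fun e => 0 < I.gain M e ∧ SecretaryStops k (I.rank M ∘ σ) (σ.symm e)

theorem mem_secretarySelect {M : Matroid U} {k : ℕ} {I : ProfitInstance U d} {σ : ArrivalOrder U}
    {e : U} : e ∈ secretarySelect M k I σ ↔
      0 < I.gain M e ∧ SecretaryStops k (I.rank M ∘ σ) (σ.symm e) := by
  simp [secretarySelect]

theorem secretarySelect_eq_singleton {M : Matroid U} {k : ℕ} {I : ProfitInstance U d}
    {σ : ArrivalOrder U} {e : U} (he : e ∈ secretarySelect M k I σ) :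
    secretarySelect M k I σ = {e} := by
  refine Finset.eq_singleton_iff_unique_mem.2 ⟨he, fun e' he' => ?_⟩
  exact σ.symm.injective
    ((mem_secretarySelect.1 he').2.unique (mem_secretarySelect.1 he).2)

theorem secretarySelect_card_le_one (M : Matroid U) (k : ℕ) (I : ProfitInstance U d)
    (σ : ArrivalOrder U) : (secretarySelect M k I σ).card ≤ 1 :=
  Finset.card_le_one.2 fun _ he _ he' => σ.symm.injective
    ((mem_secretarySelect.1 he).2.unique (mem_secretarySelect.1 he').2)

theorem mem_secretarySelect_of_agreeOn {M : Matroid U} {k : ℕ} {I J : ProfitInstance U d}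
    {σ τ : ArrivalOrder U} {t : Fin (Fintype.card U)} (hστ : ∀ i ≤ t, σ i = τ i)
    (h : I.AgreeOn J (σ '' Set.Iic t)) (hmem : σ t ∈ secretarySelect M k I σ) :
    τ t ∈ secretarySelect M k J τ := by
  rw [mem_secretarySelect, Equiv.symm_apply_apply] at hmem ⊢
  have hgain : ∀ i ≤ t, I.gain M (σ i) = J.gain M (τ i) := fun i hi => by
    rw [← hστ i hi]
    exact h.gain_eq M ⟨i, hi, rfl⟩
  refine ⟨hgain t le_rfl ▸ hmem.1, hmem.2.congr fun i hi => ?_⟩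
  simp only [Function.comp_apply, ProfitInstance.rank, hgain i hi]
  rw [hστ i hi]

/-- The secretary rule with an observation phase of length `k`, as an online algorithm. -/
noncomputable def secretaryAlgorithm (M : Matroid U) (d k : ℕ) : OnlineAlgorithm M d where
  Ω := Unit
  μ := Measure.dirac ()
  select _ I σ := secretarySelect M k I σ
  measurableSet_select _ _ _ := MeasurableSet.const _
  indep_select _ I σ := by
    rcases (secretarySelect M k I σ).eq_empty_or_nonempty with h | ⟨e, he⟩
    · rw [h, Finset.coe_empty]
      exact M.empty_indep
    · rw [secretarySelect_eq_singleton he, Finset.coe_singleton]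
      exact ProfitInstance.indep_of_gain_pos (mem_secretarySelect.1 he).1
  nonanticipating _ I J σ τ t hστ h := by
    refine ⟨mem_secretarySelect_of_agreeOn hστ h,
      mem_secretarySelect_of_agreeOn (fun i hi => (hστ i hi).symm) ?_⟩
    have himage : τ '' Set.Iic t = σ '' Set.Iic t :=
      Set.image_congr fun i hi => (hστ i hi).symm
    rw [himage]
    exact ⟨h.1.symm, fun e he => (h.2.1 e he).symm, fun B hB => (h.2.2 B hB).symm⟩

theorem exists_isSingleSecretary [DecidableEq U] (M : Matroid U) (d : ℕ)
    {C : Set (ProfitInstance U d)} (hC : ∀ I ∈ C, I.profit ∅ = 0) :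
    ∃ S : OnlineAlgorithm M d, S.IsSingleSecretary C := by
  classical
  obtain ⟨k, hk⟩ := exists_secretaryStops_card U
  refine ⟨secretaryAlgorithm M d k, fun _ => secretarySelect_card_le_one M k, ?_⟩
  intro I hI B hB hB1
  have hint : ∀ σ, ∫ ω, I.profit ((secretaryAlgorithm M d k).select ω I σ)
      ∂(secretaryAlgorithm M d k).μ = I.profit (secretarySelect M k I σ) := fun σ =>
    integral_dirac (fun _ : Unit => I.profit (secretarySelect M k I σ)) ()
  have hcard : (0 : ℝ) < Fintype.card (ArrivalOrder U) := by
    exact_mod_cast Fintype.card_pos_iff.2 ⟨(Fintype.equivFin U).symm⟩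
  unfold OnlineAlgorithm.expectedProfit
  simp only [hint]
  rw [le_div_iff₀ hcard]
  -- Only items of positive gain are accepted, so orders in which the best item is missed do no
  -- harm.
  have hnonneg : ∀ σ, 0 ≤ I.profit (secretarySelect M k I σ) := by
    intro σ
    rcases (secretarySelect M k I σ).eq_empty_or_nonempty with h | ⟨e, he⟩
    · rw [h, hC I hI]
    · have hpos := (mem_secretarySelect.1 he).1
      rw [secretarySelect_eq_singleton he, ProfitInstance.profit_eq_gain hpos]
      exact hpos.le
  rcases le_or_gt (I.profit B) 0 with hneg | hpos
  · refine le_trans ?_ (Finset.sum_nonneg fun σ _ => hnonneg σ)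
    exact mul_nonpos_of_nonpos_of_nonneg
      (mul_nonpos_of_nonneg_of_nonpos (by positivity) hneg) hcard.le
  obtain ⟨b, rfl⟩ : ∃ b, B = {b} := by
    rcases B.eq_empty_or_nonempty with rfl | hne
    · exact absurd (hC I hI) hpos.ne'
    · exact Finset.card_eq_one.1 (le_antisymm hB1 hne.card_pos)
  have hgb : I.profit {b} ≤ I.gain M b := by
    rw [Finset.coe_singleton] at hB
    simp [ProfitInstance.gain, hB]
  -- The top-ranked `e` may differ from `b`, but its gain is at least as large.
  obtain ⟨e, -, he⟩ := Finset.exists_max_image Finset.univ (I.rank M) ⟨b, Finset.mem_univ b⟩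
  have hbe : I.gain M b ≤ I.gain M e := Prod.Lex.monotone_fst _ _ (he b (Finset.mem_univ b))
  have hge : 0 < I.gain M e := hpos.trans_le (hgb.trans hbe)
  have hcount := hk (I.rank M) (I.rank_injective M) e fun e' => he e' (Finset.mem_univ e')
  set W := Finset.univ.filter fun σ : ArrivalOrder U =>
    SecretaryStops k (I.rank M ∘ σ) (σ.symm e)
  calc (Real.exp 1)⁻¹ * I.profit {b} * Fintype.card (ArrivalOrder U)
      = ((Real.exp 1)⁻¹ * Fintype.card (ArrivalOrder U)) * I.profit {b} := by ring
    _ ≤ W.card * I.gain M e := by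
        gcongr
        exact hgb.trans hbe
    _ = ∑ σ ∈ W, I.gain M e := by rw [Finset.sum_const, nsmul_eq_mul]
    _ = ∑ σ ∈ W, I.profit (secretarySelect M k I σ) := by
        refine Finset.sum_congr rfl fun σ hσ => ?_
        rw [secretarySelect_eq_singleton
          (mem_secretarySelect.2 ⟨hge, (Finset.mem_filter.1 hσ).2⟩),
          ProfitInstance.profit_eq_gain hge]
    _ ≤ ∑ σ, I.profit (secretarySelect M k I σ) :=
        Finset.sum_le_sum_of_subset_of_nonneg (Finset.subset_univ _) fun σ _ _ => hnonneg σ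

end Secretary

theorem mainTheorem5 {U : Type*} [Fintype U] [DecidableEq U] (M : Matroid U)
    (d : ℕ) (hd : 0 < d)
    (𝒱 : Set (Finset U → ℝ)) (h𝒱 : ∀ v ∈ 𝒱, IsSubmodularValue v)
    (β : ℝ) (hβ : 0 < β)
    (A : OnlineAlgorithm M d) (hA : A.IsApproximation β (separableInstances d 𝒱)) :
    (∃ S : OnlineAlgorithm M d, S.IsSingleSecretary (supermodularInstances d 𝒱)) ∧
      ∀ S : OnlineAlgorithm M d, S.IsSingleSecretary (supermodularInstances d 𝒱) →
        (OnlineAlgorithm.reduction β hβ A S).IsApproximation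
          ((d : ℝ) * (β + 2 * Real.exp 1 * (d : ℝ))) (supermodularInstances d 𝒱) := by
  refine ⟨exists_isSingleSecretary M d fun I hI => ?_, fun S hS =>
    OnlineAlgorithm.reduction_isApproximation hd h𝒱 β hβ A S hA hS⟩
  simp [ProfitInstance.profit, (h𝒱 _ hI.1).1, hI.2.1.1]
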